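/- Let $\mathbb{T}^3=(\mathbb{R}/\mathbb{Z})^3$, and let $L^2_{\mathrm{sol},0}$ be the space of $b\in L^2(\mathbb{T}^3;\mathbb{C}^3)$ (in particular, real-valued $b$ are included) with $\nabla\cdot b=0$ in the sense of distributions and $\int_{\mathbb{T}^3} b\,dx=0$. Write $\hat b(k)=\int_{\mathbb{T}^3}e^{-2\pi i k\cdot x}b(x)\,dx$ for $k\in\mathbb{Z}^3$. There are constants $C(\ell,\alpha)$, $\ell\in\mathbb{N}$, $\alpha\in\mathbb{N}^3$, such that for every $\kappa\ge 0$ and every $b_0\in L^2_{\mathrm{sol},0}$ with $b_0\neq 0$ there exist a time $T>0$, a Fourier mode $k\in\mathbb{Z}^3$ with $|k|=1$, and a velocity field $u\in C_c^\infty((0,T)\times\mathbb{T}^3;\mathbb{R}^3)$, extended by zero to all other times, with $\nabla\cdot u=0$ and $$\|\partial_t^\ell\partial_x^\alpha u\|_{L^\infty_{t,x}}\le C(\ell,\alpha)\qquad\text{for all }\ell,\alpha,$$ such that the following holds. If $b\in C([0,\infty);L^2(\mathbb{T}^3;\mathbb{C}^3))$ solves $$\partial_t b-\kappa\Delta b+u\cdot\nabla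 b-b\cdot\nabla u=0,\qquad b(0,\cdot)=b_0,$$ in the sense of distributions, then $\hat b(t,k)\neq 0$ for every $t\ge T$. The constants $C(\ell,\alpha)$ depend neither on $b_0$ nor on $\kappa$. -/

import Mathlib

open MeasureTheory Set
open scoped ContDiff

noncomputable section

namespace Dynamo

/-- The flat torus `𝕋³ = (ℝ / ℤ)³`. -/
abbrev Torus3 : Type := UnitAddTorus (Fin 3)

/-- The Haar probability measure on `𝕋³` (the measure used by `UnitAddTorus.mFourierCoeff`). -/
abbrev torusMeasure : Measure Torus3 := Measure.pi fun _ => AddCircle.haarAddCircle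

/-- `L²(𝕋³; ℂ³)`; it contains the real-valued fields. -/
abbrev L2Field : Type := Lp (EuclideanSpace ℂ (Fin 3)) 2 torusMeasure

/-- A time-dependent velocity field. -/
abbrev Velocity : Type := ℝ → Torus3 → EuclideanSpace ℝ (Fin 3)

/-- The projection `ℝ³ → 𝕋³`. -/
def toTorus (y : Fin 3 → ℝ) : Torus3 := fun i => (y i : UnitAddCircle)

section Derivatives

variable {F : Type*} [NormedAddCommGroup F] [NormedSpace ℝ F]

/-- A function on `𝕋³` is smooth when its periodic lift to `ℝ³` is `C^∞`. -/
def TorusSmooth (f : Torus3 → F) : Prop :=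
  ContDiff ℝ ∞ fun y : Fin 3 → ℝ => f (toTorus y)

/-- The partial derivative `∂f/∂xᵢ` on `𝕋³`. -/
def partialX (i : Fin 3) (f : Torus3 → F) (x : Torus3) : F :=
  deriv (fun s : ℝ => f (x + Pi.single i (s : UnitAddCircle))) 0

/-- The Laplacian `∑ᵢ ∂²f/∂xᵢ²` on `𝕋³`. -/
def laplacian (f : Torus3 → F) (x : Torus3) : F :=
  ∑ i, partialX i (partialX i f) x

/-- The spatial derivative `∂ₓ^α` for a multi-index `α ∈ ℕ³`. -/
def partialMulti (α : Fin 3 → ℕ) (f : Torus3 → F) : Torus3 → F :=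
  (partialX 0)^[α 0] ((partialX 1)^[α 1] ((partialX 2)^[α 2] f))

/-- The mixed derivative `∂ₜ^ℓ ∂ₓ^α u (t, x)`. -/
def partialMixed (ℓ : ℕ) (α : Fin 3 → ℕ) (u : ℝ → Torus3 → F) (t : ℝ) (x : Torus3) : F :=
  iteratedDeriv ℓ (fun s => partialMulti α (u s) x) t

end Derivatives

/-- `u ∈ C_c^∞((0,T) × 𝕋³; ℝ³)`, extended by zero to all times. -/
structure SmoothCompactlySupported (T : ℝ) (u : Velocity) : Prop where
  smooth : ContDiff ℝ ∞ fun p : ℝ × (Fin 3 → ℝ) => u p.1 (toTorus p.2)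
  compact : HasCompactSupport fun p : ℝ × Torus3 => u p.1 p.2
  support : tsupport (fun p : ℝ × Torus3 => u p.1 p.2) ⊆ Ioo 0 T ×ˢ univ

/-- `∇ · u = 0` for a smooth velocity field. -/
def DivergenceFree (u : Velocity) : Prop :=
  ∀ t x, ∑ i, partialX i (fun y => u t y i) x = 0

/-- Membership in `L²_{sol,0}(𝕋³)`: weakly divergence-free and of mean zero. -/
structure IsSolenoidalMeanZero (b : L2Field) : Prop where
  divFree : ∀ φ : Torus3 → ℂ, TorusSmooth φ →
    ∫ x, ∑ i, b x i * partialX i φ x ∂torusMeasure = 0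
  meanZero : ∫ x, b x ∂torusMeasure = 0

/-- `b ∈ C([0,∞); L²(𝕋³))` solves, for a smooth divergence-free `u`, the induction equation
`∂ₜ b - κ Δ b + u · ∇ b - b · ∇ u = 0`, `b(0) = b₀`, in the sense of distributions: for each
component `i`, each smooth `φ` and each `t ≥ 0`,
`⟨bᵢ(t), φ⟩ = ⟨b₀ᵢ, φ⟩ + ∫₀ᵗ (κ ⟨bᵢ, Δφ⟩ + ⟨bᵢ, u · ∇φ⟩ + ⟨b · ∇uᵢ, φ⟩) ds`.
Only the values `b t` for `t ≥ 0` matter. -/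
structure SolvesInduction (κ : ℝ) (u : Velocity) (b₀ : L2Field) (b : ℝ → L2Field) : Prop where
  continuousOn : ContinuousOn b (Ici 0)
  initial : b 0 = b₀
  weak : ∀ (i : Fin 3) (φ : Torus3 → ℂ), TorusSmooth φ → ∀ t : ℝ, 0 ≤ t →
    ∫ x, b t x i * φ x ∂torusMeasure =
      ∫ x, b₀ x i * φ x ∂torusMeasure +
      ∫ s in (0 : ℝ)..t, ∫ x,
        ((κ : ℂ) * (b s x i * laplacian φ x)
          + b s x i * ∑ j, (u s x j : ℂ) * partialX j φ x
          + (∑ j, b s x j * (partialX j (fun y => u s y i) x : ℂ)) * φ x) ∂torusMeasure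

end Dynamo

end

noncomputable section

namespace Dynamo

open UnitAddTorus Complex ComplexConjugate

/-! ### Characters of the torus as eigenfunctions -/

section Characters

/-! One small shear wave can push a nonzero mode `k₀` of the initial field onto a unit mode. Pick a
component `i` with `fourierComp b₀ k₀ i ≠ 0` and set `k = e_i`, `m = k - k₀`. Pick `a ≠ 0`
orthogonal to `k` and `k₀`, hence to `m`, and let `u = f(t) Re(c e^{2πi m·x}) a` with a bump `f` in
`(0,1)`.

On modes orthogonal to `a` the advection term vanishes, and stretching forces the mode `q` only in
the direction `a`, through `m · b̂(q ± m)`. Since `a · m = 0`, these scalars feel no forcing and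
follow the heat flow (`fluxComp_eq`). The infinite chain of modes thus closes, and `b̂(t,k)` is
explicit (`fourierComp_eq_transfer`): up to a positive factor, its component `p` is `P + Q (c J -
conj c J')`. Here `J` is a positive weight times `m · b̂₀(k₀)`, which equals the chosen component by
the divergence condition (`fluxComp_single_sub`). As `J ≠ 0`, arbitrarily small `c` makes the
expression nonzero (`exists_mul_add_ne_zero`).

Uniform bounds come from taking the amplitude exponentially small in `|m|`. The value of `c` may
depend on `κ` and `b₀`, but the derivative bounds do not. -/

lemma mFourier_add_apply (q : Fin 3 → ℤ) (x y : Torus3) :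
    mFourier q (x + y) = mFourier q x * mFourier q y := by
  simp [mFourier, fourier_apply, smul_add, AddCircle.toCircle_add, Finset.prod_mul_distrib]

lemma mFourier_pi_single (q : Fin 3 → ℤ) (j : Fin 3) (s : UnitAddCircle) :
    mFourier q (Pi.single j s) = fourier (q j) s := by
  simp only [mFourier, ContinuousMap.coe_mk]
  rw [Finset.prod_eq_single j]
  · simp
  · intro i _ hij
    rw [Pi.single_eq_of_ne hij, fourier_eval_zero]
  · simp

lemma hasDerivAt_mFourier_add_single (q : Fin 3 → ℤ) (j : Fin 3) (x : Torus3) :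
    HasDerivAt (fun s : ℝ => mFourier q (x + Pi.single j (s : UnitAddCircle)))
      (2 * Real.pi * I * q j * mFourier q x) 0 := by
  have h := (hasDerivAt_fourier 1 (q j) 0).const_mul (mFourier q x)
  simp only [mFourier_add_apply, mFourier_pi_single]
  convert! h using 1
  simp
  ring

lemma contDiff_mFourier_toTorus (q : Fin 3 → ℤ) :
    ContDiff ℝ ∞ fun y : Fin 3 → ℝ => mFourier q (toTorus y) := by
  simp only [mFourier, ContinuousMap.coe_mk, toTorus, fourier_coe_apply]
  refine contDiff_prod fun i _ => ?_
  have h : ContDiff ℝ ∞ fun y : Fin 3 → ℝ => ((y i : ℝ) : ℂ) :=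
    ofRealCLM.contDiff.comp (contDiff_apply ℝ ℝ i)
  exact ((contDiff_const.mul h).div_const _).cexp

lemma torusSmooth_mFourier (q : Fin 3 → ℤ) : TorusSmooth fun x => mFourier q x :=
  contDiff_mFourier_toTorus q

lemma norm_mFourier_apply_le (q : Fin 3 → ℤ) (x : Torus3) : ‖mFourier q x‖ ≤ 1 :=
  ((mFourier q).norm_coe_le_norm x).trans mFourier_norm.le

lemma partialX_const_mul_mFourier (q : Fin 3 → ℤ) (j : Fin 3) (c : ℂ) :
    partialX j (fun x => c * mFourier q x) =
      fun x => (2 * Real.pi * I * q j * c) * mFourier q x := by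
  funext x
  refine ((hasDerivAt_mFourier_add_single q j x).const_mul c).deriv.trans ?_
  ring

lemma partialX_mFourier (q : Fin 3 → ℤ) (j : Fin 3) :
    partialX j (fun x => mFourier q x) = fun x => (2 * Real.pi * I * q j) * mFourier q x := by
  simpa using partialX_const_mul_mFourier q j 1

/-- The eigenvalue `4 π² |q|²` of `-Δ` at the mode `q`. -/
def eigenvalue (q : Fin 3 → ℤ) : ℝ := 4 * Real.pi ^ 2 * ∑ j, (q j : ℝ) ^ 2

lemma laplacian_mFourier (q : Fin 3 → ℤ) (x : Torus3) :
    laplacian (fun x => mFourier q x) x = -(eigenvalue q : ℂ) * mFourier q x := by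
  simp only [laplacian, partialX_mFourier, partialX_const_mul_mFourier, eigenvalue]
  push_cast
  rw [Finset.mul_sum, ← Finset.sum_neg_distrib, Finset.sum_mul]
  refine Finset.sum_congr rfl fun j _ => ?_
  linear_combination (4 * Real.pi ^ 2 * (q j : ℂ) ^ 2 * mFourier q x) * I_sq

lemma eigenvalue_neg (q : Fin 3 → ℤ) : eigenvalue (-q) = eigenvalue q := by
  simp [eigenvalue]

end Characters

/-! ### Real plane waves and their derivatives -/

section Wave

/-- The plane wave `Re (c e^{2πi m·x})`. -/
def wave (m : Fin 3 → ℤ) (c : ℂ) (x : Torus3) : ℝ := (c * mFourier m x).re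

lemma abs_wave_le (m : Fin 3 → ℤ) (c : ℂ) (x : Torus3) : |wave m c x| ≤ ‖c‖ :=
  (abs_re_le_norm _).trans <| by
    rw [norm_mul]
    exact mul_le_of_le_one_right (norm_nonneg _) (norm_mFourier_apply_le m x)

lemma contDiff_wave_toTorus (m : Fin 3 → ℤ) (c : ℂ) :
    ContDiff ℝ ∞ fun y : Fin 3 → ℝ => wave m c (toTorus y) :=
  reCLM.contDiff.comp (contDiff_const.mul (contDiff_mFourier_toTorus m))

lemma ofReal_wave (m : Fin 3 → ℤ) (c : ℂ) (x : Torus3) :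
    (wave m c x : ℂ) = (c * mFourier m x + conj c * mFourier (-m) x) / 2 := by
  rw [wave, re_eq_add_conj, map_mul, mFourier_neg]

lemma hasDerivAt_wave_add_single (m : Fin 3 → ℤ) (j : Fin 3) (c : ℂ) (x : Torus3) :
    HasDerivAt (fun s : ℝ => wave m c (x + Pi.single j (s : UnitAddCircle)))
      (wave m (2 * Real.pi * I * m j * c) x) 0 := by
  have h := (hasDerivAt_mFourier_add_single m j x).const_mul c
  have h' := reCLM.hasFDerivAt.comp_hasDerivAt (0 : ℝ) h
  convert! h' using 1
  simp only [wave, reCLM_apply]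
  ring_nf

variable {F : Type*} [NormedAddCommGroup F] [NormedSpace ℝ F]

lemma partialX_wave_smul (m : Fin 3 → ℤ) (j : Fin 3) (c : ℂ) (v : F) :
    partialX j (fun x => wave m c x • v) = fun x => wave m (2 * Real.pi * I * m j * c) x • v :=
  funext fun x => ((hasDerivAt_wave_add_single m j c x).smul_const v).deriv

lemma iterate_partialX_wave_smul (m : Fin 3 → ℤ) (j : Fin 3) (v : F) (n : ℕ) (c : ℂ) :
    (partialX j)^[n] (fun x => wave m c x • v) =
      fun x => wave m ((2 * Real.pi * I * m j) ^ n * c) x • v := by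
  induction n generalizing c with
  | zero => simp
  | succ n ih =>
    rw [Function.iterate_succ_apply, partialX_wave_smul, ih]
    ring_nf

lemma partialMulti_wave_smul (m : Fin 3 → ℤ) (α : Fin 3 → ℕ) (c : ℂ) (v : F) :
    partialMulti α (fun x => wave m c x • v) =
      fun x => wave m ((∏ j, (2 * Real.pi * I * m j) ^ α j) * c) x • v := by
  simp only [partialMulti, iterate_partialX_wave_smul, Fin.prod_univ_three, mul_assoc]

end Wave

/-! ### Shear flows: incompressibility, support, derivative bounds -/

section ShearFlow

/-- The shear flow `f(t) Re (c e^{2πi m·x}) a`. -/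
def shearFlow (f : ℝ → ℝ) (m : Fin 3 → ℤ) (c : ℂ) (a : EuclideanSpace ℝ (Fin 3)) : Velocity :=
  fun t x => wave m c x • f t • a

lemma shearFlow_apply (f : ℝ → ℝ) (m : Fin 3 → ℤ) (c : ℂ) (a : EuclideanSpace ℝ (Fin 3))
    (t : ℝ) (x : Torus3) (i : Fin 3) :
    shearFlow f m c a t x i = wave m c x • (f t * a i) := by
  simp [shearFlow]

lemma partialX_shearFlow (f : ℝ → ℝ) (m : Fin 3 → ℤ) (c : ℂ) (a : EuclideanSpace ℝ (Fin 3))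
    (t : ℝ) (x : Torus3) (i j : Fin 3) :
    partialX j (fun y => shearFlow f m c a t y i) x =
      wave m (2 * Real.pi * I * m j * c) x * (f t * a i) := by
  simp only [shearFlow_apply]
  exact congrFun (partialX_wave_smul m j c (f t * a i)) x

lemma wave_deriv (m : Fin 3 → ℤ) (j : Fin 3) (c : ℂ) (x : Torus3) :
    wave m (2 * Real.pi * I * m j * c) x = m j * wave m (2 * Real.pi * I * c) x := by
  have h : 2 * Real.pi * I * m j * c * mFourier m x =
      ((m j : ℝ) : ℂ) * (2 * Real.pi * I * c * mFourier m x) := by push_cast; ring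
  rw [wave, h, re_ofReal_mul, wave]

lemma partialX_ofReal_shearFlow (f : ℝ → ℝ) (m : Fin 3 → ℤ) (c : ℂ)
    (a : EuclideanSpace ℝ (Fin 3)) (t : ℝ) (x : Torus3) (i j : Fin 3) :
    partialX j (fun y => (shearFlow f m c a t y i : ℂ)) x =
      (m j * wave m (2 * Real.pi * I * c) x * (f t * a i) : ℝ) := by
  have h := ((hasDerivAt_wave_add_single m j c x).mul_const (f t * a i)).ofReal_comp
  rw [wave_deriv] at h
  simp only [shearFlow_apply, smul_eq_mul]
  exact h.deriv

lemma divergenceFree_shearFlow (f : ℝ → ℝ) {m : Fin 3 → ℤ} (c : ℂ)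
    {a : EuclideanSpace ℝ (Fin 3)} (ham : ∑ j, a j * m j = 0) :
    DivergenceFree (shearFlow f m c a) := by
  intro t x
  simp only [partialX_shearFlow, wave_deriv]
  have h : ∀ j, (m j : ℝ) * wave m (2 * Real.pi * I * c) x * (f t * a j) =
      (a j * m j) * (wave m (2 * Real.pi * I * c) x * f t) := fun j => by ring
  simp only [h, ← Finset.sum_mul, ham, zero_mul]

lemma smoothCompactlySupported_shearFlow {f : ℝ → ℝ} {T : ℝ} (hf : ContDiff ℝ ∞ f)
    (hfc : HasCompactSupport f) (hfT : tsupport f ⊆ Ioo 0 T) (m : Fin 3 → ℤ) (c : ℂ)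
    (a : EuclideanSpace ℝ (Fin 3)) :
    SmoothCompactlySupported T (shearFlow f m c a) := by
  have hsub : tsupport (fun p : ℝ × Torus3 => shearFlow f m c a p.1 p.2) ⊆
      tsupport f ×ˢ univ := by
    refine closure_minimal ?_ ((isClosed_tsupport f).prod isClosed_univ)
    intro p hp
    refine ⟨subset_tsupport f fun h => hp ?_, mem_univ _⟩
    simp [shearFlow, h]
  refine ⟨?_, ?_, hsub.trans (prod_mono hfT le_rfl)⟩
  · exact ((contDiff_wave_toTorus m c).comp contDiff_snd).smul
      ((hf.comp contDiff_fst).smul contDiff_const)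
  · exact (hfc.isCompact.prod isCompact_univ).of_isClosed_subset (isClosed_tsupport _) hsub

lemma partialMixed_shearFlow {f : ℝ → ℝ} (hf : ContDiff ℝ ∞ f) (m : Fin 3 → ℤ) (c : ℂ)
    (a : EuclideanSpace ℝ (Fin 3)) (ℓ : ℕ) (α : Fin 3 → ℕ) (t : ℝ) (x : Torus3) :
    partialMixed ℓ α (shearFlow f m c a) t x =
      wave m ((∏ j, (2 * Real.pi * I * m j) ^ α j) * c) x • iteratedDeriv ℓ f t • a := by
  have hft : ContDiffAt ℝ ℓ f t := (hf.of_le (by exact_mod_cast le_top)).contDiffAt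
  have h : (fun s => partialMulti α (shearFlow f m c a s) x) = fun s =>
      wave m ((∏ j, (2 * Real.pi * I * m j) ^ α j) * c) x • f s • a :=
    funext fun s => congrFun (partialMulti_wave_smul m α c (f s • a)) x
  rw [partialMixed, h, iteratedDeriv_fun_const_smul_field, iteratedDeriv_smul_const hft]

lemma norm_partialMixed_shearFlow_le {f : ℝ → ℝ} (hf : ContDiff ℝ ∞ f) (m : Fin 3 → ℤ) (c : ℂ)
    (a : EuclideanSpace ℝ (Fin 3)) (ℓ : ℕ) (α : Fin 3 → ℕ) (t : ℝ) (x : Torus3) :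
    ‖partialMixed ℓ α (shearFlow f m c a) t x‖ ≤
      (2 * Real.pi * ∑ j, |(m j : ℝ)|) ^ (∑ j, α j) * ‖c‖ * (|iteratedDeriv ℓ f t| * ‖a‖) := by
  rw [partialMixed_shearFlow hf, norm_smul, norm_smul, Real.norm_eq_abs, Real.norm_eq_abs]
  refine mul_le_mul_of_nonneg_right ((abs_wave_le _ _ _).trans ?_) (by positivity)
  rw [norm_mul, norm_prod, ← Finset.prod_pow_eq_pow_sum]
  refine mul_le_mul_of_nonneg_right (Finset.prod_le_prod (fun _ _ => norm_nonneg _) fun j _ => ?_)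
    (norm_nonneg _)
  rw [norm_pow]
  refine pow_le_pow_left₀ (norm_nonneg _) ?_ _
  have h : |(m j : ℝ)| ≤ ∑ j, |(m j : ℝ)| :=
    Finset.single_le_sum (f := fun j => |(m j : ℝ)|) (fun _ _ => abs_nonneg _) (Finset.mem_univ j)
  have h2 : ‖(2 * Real.pi * I * m j : ℂ)‖ = 2 * Real.pi * |(m j : ℝ)| := by
    simp [abs_of_pos Real.pi_pos]
  rw [h2]
  gcongr

/-- A wave whose amplitude is exponentially small in its frequency has derivatives bounded
independently of the frequency. -/
lemma norm_partialMixed_shearFlow_le_of_le_exp {f : ℝ → ℝ} (hf : ContDiff ℝ ∞ f) {m : Fin 3 → ℤ}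
    {c : ℂ} {a : EuclideanSpace ℝ (Fin 3)}
    (hc : ‖c‖ * ‖a‖ ≤ Real.exp (-(2 * Real.pi * ∑ j, |(m j : ℝ)|))) {ℓ : ℕ} {B : ℝ}
    (hB : ∀ t, |iteratedDeriv ℓ f t| ≤ B) (α : Fin 3 → ℕ) (t : ℝ) (x : Torus3) :
    ‖partialMixed ℓ α (shearFlow f m c a) t x‖ ≤ ((∑ j, α j).factorial : ℝ) * B := by
  set M : ℝ := 2 * Real.pi * ∑ j, |(m j : ℝ)| with hM
  set n : ℕ := ∑ j, α j
  have hM0 : 0 ≤ M := by positivity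
  refine (norm_partialMixed_shearFlow_le hf m c a ℓ α t x).trans ?_
  -- A single term of the exponential series: `n` derivatives cost `M ^ n`, which the amplitude `exp
  -- (-M)` absorbs up to `n!`.
  have h1 : M ^ n ≤ n.factorial * Real.exp M := by
    have := Real.pow_div_factorial_le_exp M hM0 n
    rwa [div_le_iff₀ (by positivity), mul_comm] at this
  calc M ^ n * ‖c‖ * (|iteratedDeriv ℓ f t| * ‖a‖)
      = M ^ n * (‖c‖ * ‖a‖) * |iteratedDeriv ℓ f t| := by ring
    _ ≤ (n.factorial * Real.exp M) * Real.exp (-M) * B := by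
        gcongr
        exact hB t
    _ = n.factorial * B := by
        rw [mul_assoc (n.factorial : ℝ), ← Real.exp_add]
        simp

end ShearFlow

/-! ### Variation of constants for one mode -/

section Duhamel

/-- The variation-of-constants formula. -/
lemma duhamel {g h : ℝ → ℂ} (hg : ContinuousOn g (Ici 0)) (hh : ContinuousOn h (Ici 0)) (μ : ℝ)
    {g₀ : ℂ} (heq : ∀ t, 0 ≤ t → g t = g₀ + ∫ s in (0 : ℝ)..t, (-(μ : ℂ) * g s + h s))
    {t : ℝ} (ht : 0 ≤ t) :
    cexp (μ * t) * g t = g₀ + ∫ s in (0 : ℝ)..t, cexp (μ * s) * h s := by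
  have hg0 : g 0 = g₀ := by simpa using heq 0 le_rfl
  have hr : ContinuousOn (fun s => -(μ : ℂ) * g s + h s) (Ici 0) :=
    (continuousOn_const.mul hg).add hh
  have hexp : Continuous fun s : ℝ => cexp (μ * s) := by fun_prop
  have hsub : Icc 0 t ⊆ Ici (0 : ℝ) := fun s hs => hs.1
  have key := intervalIntegral.integral_eq_sub_of_hasDerivAt_of_le ht
    (f := fun s : ℝ => cexp (μ * s) * g s) (f' := fun s : ℝ => cexp (μ * s) * h s)
    (hexp.continuousOn.mul (hg.mono hsub)) (fun s hs => ?_)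
    (((hexp.continuousOn.mul (hh.mono hsub)).mono
      (by rw [uIcc_of_le ht])).intervalIntegrable)
  · rw [key, hg0]
    simp
  · have hs0 : Ici (0 : ℝ) ∈ nhds s := Ici_mem_nhds hs.1
    have hd : HasDerivAt (fun s => g₀ + ∫ r in (0 : ℝ)..s, (-(μ : ℂ) * g r + h r))
        (-(μ : ℂ) * g s + h s) s := by
      refine (intervalIntegral.integral_hasDerivAt_right ?_ ?_ (hr.continuousAt hs0)).const_add g₀
      · refine (hr.mono ?_).intervalIntegrable
        rw [uIcc_of_le hs.1.le]
        exact fun r hr => hr.1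
      · exact ContinuousOn.stronglyMeasurableAtFilter isOpen_Ioi (hr.mono Ioi_subset_Ici_self) s
          hs.1
    have hg' : HasDerivAt g (-(μ : ℂ) * g s + h s) s :=
      hd.congr_of_eventuallyEq (Filter.mem_of_superset hs0 heq)
    have he : HasDerivAt (fun s : ℝ => cexp (μ * s)) (cexp (μ * s) * (μ * 1)) s :=
      ((hasDerivAt_id s).ofReal_comp.const_mul (μ : ℂ)).cexp
    refine (he.mul hg').congr_deriv ?_
    ring

end Duhamel

/-! ### Fourier coefficients of square-integrable fields -/

section Coefficients

/-- The `p`-th component of the Fourier coefficient of `b` at the mode `q`. -/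
def fourierComp (b : L2Field) (q : Fin 3 → ℤ) (p : Fin 3) : ℂ :=
  ∫ x, b x p * mFourier (-q) x ∂torusMeasure

lemma memLp_component (b : L2Field) (p : Fin 3) :
    MemLp (fun x => b x p) 2 torusMeasure :=
  (EuclideanSpace.proj (𝕜 := ℂ) p).comp_memLp' (Lp.memLp b)

lemma integrable_component_mul_mFourier (b : L2Field) (q : Fin 3 → ℤ) (p : Fin 3) :
    Integrable (fun x => b x p * mFourier q x) torusMeasure :=
  ((memLp_component b p).integrable one_le_two).mul_bdd (c := 1)
    (mFourier q).continuous.aestronglyMeasurable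
    (Filter.Eventually.of_forall (norm_mFourier_apply_le q))

lemma mFourierCoeff_apply (b : L2Field) (q : Fin 3 → ℤ) (p : Fin 3) :
    mFourierCoeff b q p = fourierComp b q p := by
  have hint : Integrable (fun x => mFourier (-q) x • b x) torusMeasure :=
    ((Lp.memLp b).integrable one_le_two).bdd_smul 1
      (mFourier (-q)).continuous.aestronglyMeasurable
      (Filter.Eventually.of_forall (norm_mFourier_apply_le (-q)))
  refine ((EuclideanSpace.proj (𝕜 := ℂ) p).integral_comp_comm hint).symm.trans ?_
  refine integral_congr_ae (Filter.Eventually.of_forall fun x => ?_)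
  simp [mul_comm]

lemma continuous_fourierComp (q : Fin 3 → ℤ) (p : Fin 3) :
    Continuous fun b : L2Field => fourierComp b q p := by
  have hc : Continuous fun x : Torus3 => EuclideanSpace.single p (mFourier q x) := by
    have : (fun x : Torus3 => EuclideanSpace.single p (mFourier q x)) =
        fun x => mFourier q x • EuclideanSpace.single p (1 : ℂ) := by
      funext x; ext i; simp
    rw [this]
    exact (mFourier q).continuous.smul continuous_const
  have hmem : MemLp (fun x : Torus3 => EuclideanSpace.single p (mFourier q x)) 2 torusMeasure :=
    MemLp.of_bound hc.aestronglyMeasurable 1 (Filter.Eventually.of_forall fun x => by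
      simpa using norm_mFourier_apply_le q x)
  -- The coefficient is the inner product with a fixed vector-valued character.
  have h : (fun b : L2Field => fourierComp b q p) = fun b => inner ℂ (hmem.toLp _) b := by
    funext b
    rw [L2.inner_def]
    refine integral_congr_ae ?_
    filter_upwards [hmem.coeFn_toLp] with x hx
    rw [hx, EuclideanSpace.inner_single_left, ← mFourier_neg, mul_comm]
  rw [h]
  exact continuous_const.inner continuous_id

lemma exists_fourierComp_ne_zero {b : L2Field} (hb : b ≠ 0) :
    ∃ q p, fourierComp b q p ≠ 0 := by
  by_contra! h
  refine hb ?_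
  have hcomp : ∀ p, ∀ᵐ x ∂torusMeasure, b x p = 0 := by
    intro p
    set f := (memLp_component b p).toLp _ with hf
    have hz : (mFourierBasis (d := Fin 3)).repr f = 0 := by
      ext q
      rw [mFourierBasis_repr, lp.coeFn_zero, Pi.zero_apply, ← h q p]
      refine integral_congr_ae ?_
      filter_upwards [(memLp_component b p).coeFn_toLp] with x hx
      rw [hx, smul_eq_mul, mul_comm]
    have hf0 : f = 0 := by simpa using hz
    filter_upwards [(memLp_component b p).coeFn_toLp, Lp.coeFn_zero ℂ 2 torusMeasure]
      with x hx hx0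
    rw [← hx, ← hf, hf0, hx0, Pi.zero_apply]
  refine Lp.ext ?_
  filter_upwards [ae_all_iff.2 hcomp, Lp.coeFn_zero (EuclideanSpace ℂ (Fin 3)) 2 torusMeasure]
    with x hx hx0
  rw [hx0]
  ext p
  exact hx p

lemma sum_mul_fourierComp_eq_zero {b : L2Field} (hb : IsSolenoidalMeanZero b)
    (q : Fin 3 → ℤ) : ∑ j, (q j : ℂ) * fourierComp b q j = 0 := by
  have h := hb.divFree _ (torusSmooth_mFourier (-q))
  simp only [partialX_mFourier] at h
  rw [integral_finsetSum] at h
  · have hne : (-(2 * Real.pi * I) : ℂ) ≠ 0 := by simp [Real.pi_ne_zero]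
    refine (mul_eq_zero.1 (?_ : -(2 * Real.pi * I) * _ = 0)).resolve_left hne
    rw [← h, Finset.mul_sum]
    refine Finset.sum_congr rfl fun j _ => ?_
    rw [fourierComp, ← integral_const_mul, ← integral_const_mul]
    congr 1
    funext x
    simp only [Pi.neg_apply, Int.cast_neg]
    ring
  · intro j _
    have := (integrable_component_mul_mFourier b (-q) j).const_mul
      (2 * Real.pi * I * ((-q) j : ℤ))
    refine this.congr (Filter.Eventually.of_forall fun x => ?_)
    simp only
    ring

/-- The Fourier coefficient at the mode `q` of the component of `b` in the direction `m`. -/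
def fluxComp (m : Fin 3 → ℤ) (b : L2Field) (q : Fin 3 → ℤ) : ℂ :=
  ∑ j, (m j : ℂ) * fourierComp b q j

end Coefficients

/-! ### Evolution of the modes orthogonal to the shear direction -/

section ModeEquations

variable {κ : ℝ} {f : ℝ → ℝ} {m : Fin 3 → ℤ} {c : ℂ} {a : EuclideanSpace ℝ (Fin 3)}
  {b₀ : L2Field} {b : ℝ → L2Field}

/-- The gradient of the character is parallel to `q`, the velocity to `a`. -/
lemma advection_shearFlow_mFourier {q : Fin 3 → ℤ} (haq : ∑ j, a j * q j = 0) (s : ℝ)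
    (x : Torus3) :
    ∑ j, (shearFlow f m c a s x j : ℂ) * partialX j (fun x => mFourier (-q) x) x = 0 := by
  have h : ∀ j, (shearFlow f m c a s x j : ℂ) * partialX j (fun x => mFourier (-q) x) x =
      ((a j * q j : ℝ) : ℂ) *
        (-(2 * Real.pi * I) * wave m c x * f s * mFourier (-q) x) := by
    intro j
    rw [partialX_mFourier, shearFlow_apply]
    simp only [smul_eq_mul, Pi.neg_apply]
    push_cast
    ring
  rw [Finset.sum_congr rfl fun j _ => h j, ← Finset.sum_mul, ← ofReal_sum, haq]
  simp

/-- The forcing of a Fourier mode by its two neighbours along the direction of the wave. -/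
def forcing (m : Fin 3 → ℤ) (c : ℂ) (β : L2Field) (q : Fin 3 → ℤ) : ℂ :=
  Real.pi * I * (c * fluxComp m β (q - m) - conj c * fluxComp m β (q + m))

/-- The real wave is the half-sum of the modes `m` and `-m`, so stretching couples `q` to `q - m`
and `q + m` only; this half and the `2πi` of the derivative give the `πi` in `forcing`. -/
lemma integral_induction_mFourier (β : L2Field) {q : Fin 3 → ℤ} (haq : ∑ j, a j * q j = 0)
    (p : Fin 3) (s : ℝ) :
    ∫ x, ((κ : ℂ) * (β x p * laplacian (fun x => mFourier (-q) x) x)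
          + β x p * ∑ j, (shearFlow f m c a s x j : ℂ) *
              partialX j (fun x => mFourier (-q) x) x
          + (∑ j, β x j * (partialX j (fun y => shearFlow f m c a s y p) x : ℂ)) *
              mFourier (-q) x) ∂torusMeasure =
      -((κ * eigenvalue q : ℝ) : ℂ) * fourierComp β q p + f s * a p * forcing m c β q := by
  let S : (Fin 3 → ℤ) → Torus3 → ℂ := fun q' x => ∑ j, (m j : ℂ) * (β x j * mFourier (-q') x)
  have hF := fun (q' : Fin 3 → ℤ) (j : Fin 3) => integrable_component_mul_mFourier β (-q') j
  have hS : ∀ q', Integrable (S q') torusMeasure :=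
    fun q' => integrable_finsetSum _ fun j _ => (hF q' j).const_mul _
  have hI : ∀ q', ∫ x, S q' x ∂torusMeasure = fluxComp m β q' := by
    intro q'
    rw [integral_finsetSum _ fun j _ => (hF q' j).const_mul _]
    simp only [integral_const_mul, fluxComp, fourierComp]
  have hpt : ∀ x, ((κ : ℂ) * (β x p * laplacian (fun x => mFourier (-q) x) x)
          + β x p * ∑ j, (shearFlow f m c a s x j : ℂ) *
              partialX j (fun x => mFourier (-q) x) x
          + (∑ j, β x j * (partialX j (fun y => shearFlow f m c a s y p) x : ℂ)) *
              mFourier (-q) x) =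
      -((κ * eigenvalue q : ℝ) : ℂ) * (β x p * mFourier (-q) x) +
        (f s * a p * Real.pi * I * c * S (q - m) x
          - f s * a p * Real.pi * I * conj c * S (q + m) x) := by
    intro x
    rw [advection_shearFlow_mFourier haq, laplacian_mFourier, eigenvalue_neg]
    have h1 : mFourier (-(q - m)) x = mFourier m x * mFourier (-q) x := by
      rw [← mFourier_add]; congr 2; abel
    have h2 : mFourier (-(q + m)) x = mFourier (-m) x * mFourier (-q) x := by
      rw [← mFourier_add]; congr 2; abel
    simp only [S, partialX_ofReal_shearFlow, h1, h2, ofReal_mul, ofReal_wave, map_mul,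
      conj_ofReal, conj_I, Complex.ofReal_intCast, map_ofNat, Fin.sum_univ_three]
    ring
  have hD : Integrable (fun x => f s * a p * Real.pi * I * c * S (q - m) x
      - f s * a p * Real.pi * I * conj c * S (q + m) x) torusMeasure :=
    ((hS _).const_mul _).sub ((hS _).const_mul _)
  simp only [hpt]
  rw [integral_add ((hF q p).const_mul _) hD,
    integral_const_mul, integral_sub ((hS _).const_mul _) ((hS _).const_mul _),
    integral_const_mul, integral_const_mul, hI, hI, fourierComp, forcing]
  ring

lemma fourierComp_eq_integral (hb : SolvesInduction κ (shearFlow f m c a) b₀ b) {q : Fin 3 → ℤ}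
    (haq : ∑ j, a j * q j = 0) (p : Fin 3) {t : ℝ} (ht : 0 ≤ t) :
    fourierComp (b t) q p = fourierComp b₀ q p + ∫ s in (0 : ℝ)..t,
      (-((κ * eigenvalue q : ℝ) : ℂ) * fourierComp (b s) q p +
        f s * a p * forcing m c (b s) q) := by
  have h := hb.weak p _ (torusSmooth_mFourier (-q)) t ht
  simp only [integral_induction_mFourier (b _) haq p] at h
  exact h

lemma continuousOn_fourierComp (hb : ContinuousOn b (Ici 0)) (q : Fin 3 → ℤ) (p : Fin 3) :
    ContinuousOn (fun s => fourierComp (b s) q p) (Ici 0) :=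
  (continuous_fourierComp q p).comp_continuousOn hb

lemma continuousOn_fluxComp (hb : ContinuousOn b (Ici 0)) (q : Fin 3 → ℤ) :
    ContinuousOn (fun s => fluxComp m (b s) q) (Ici 0) :=
  continuousOn_finsetSum _ fun j _ => continuousOn_const.mul (continuousOn_fourierComp hb q j)

lemma continuousOn_forcing (hf : Continuous f) (hb : ContinuousOn b (Ici 0)) (q : Fin 3 → ℤ)
    (p : Fin 3) :
    ContinuousOn (fun s => (f s * a p * forcing m c (b s) q : ℂ)) (Ici 0) :=
  ((continuous_ofReal.comp hf).continuousOn.mul continuousOn_const).mul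
    (continuousOn_const.mul ((continuousOn_const.mul (continuousOn_fluxComp hb _)).sub
      (continuousOn_const.mul (continuousOn_fluxComp hb _))))

lemma fourierComp_eq (hf : Continuous f) (hb : SolvesInduction κ (shearFlow f m c a) b₀ b)
    {q : Fin 3 → ℤ} (haq : ∑ j, a j * q j = 0) (p : Fin 3) {t : ℝ} (ht : 0 ≤ t) :
    cexp ((κ * eigenvalue q : ℝ) * t) * fourierComp (b t) q p = fourierComp b₀ q p +
      ∫ s in (0 : ℝ)..t, cexp ((κ * eigenvalue q : ℝ) * s) *
        (f s * a p * forcing m c (b s) q) :=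
  duhamel (g := fun s => fourierComp (b s) q p) (continuousOn_fourierComp hb.continuousOn q p)
    (continuousOn_forcing hf hb.continuousOn q p) (κ * eigenvalue q)
    (fun _ ht => fourierComp_eq_integral hb haq p ht) ht

/-- The component in the direction of variation of the shear is not affected by the shear. -/
lemma fluxComp_eq (hf : Continuous f) (ham : ∑ j, a j * m j = 0)
    (hb : SolvesInduction κ (shearFlow f m c a) b₀ b) {q : Fin 3 → ℤ}
    (haq : ∑ j, a j * q j = 0) {t : ℝ} (ht : 0 ≤ t) :
    cexp ((κ * eigenvalue q : ℝ) * t) * fluxComp m (b t) q = fluxComp m b₀ q := by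
  have hham : (∑ j, (m j : ℂ) * (a j : ℂ)) = 0 := by
    have := congrArg (fun r : ℝ => (r : ℂ)) ham
    simpa [mul_comm] using this
  have hint : ∀ j, IntervalIntegrable (fun s => cexp ((κ * eigenvalue q : ℝ) * s) *
      (f s * a j * forcing m c (b s) q)) volume 0 t := by
    intro j
    have hexp : Continuous fun s : ℝ => cexp ((κ * eigenvalue q : ℝ) * s) := by fun_prop
    refine ((hexp.continuousOn.mul
      (continuousOn_forcing hf hb.continuousOn q j)).mono ?_).intervalIntegrable
    rw [uIcc_of_le ht]
    exact fun s hs => hs.1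
  -- The forcing points along `a`, which is orthogonal to `m`.
  have hsum : ∑ j, (m j : ℂ) * ∫ s in (0 : ℝ)..t, cexp ((κ * eigenvalue q : ℝ) * s) *
      (f s * a j * forcing m c (b s) q) = 0 := by
    simp only [← intervalIntegral.integral_const_mul]
    rw [← intervalIntegral.integral_finsetSum fun j _ => (hint j).const_mul _]
    refine (intervalIntegral.integral_congr fun s _ => ?_).trans intervalIntegral.integral_zero
    have h : ∀ j, (m j : ℂ) * (cexp ((κ * eigenvalue q : ℝ) * s) *
        (f s * a j * forcing m c (b s) q)) = (m j * a j) *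
          (cexp ((κ * eigenvalue q : ℝ) * s) * f s * forcing m c (b s) q) := fun j => by ring
    simp only [h, ← Finset.sum_mul, hham, zero_mul]
  simp only [fluxComp, Finset.mul_sum]
  calc ∑ j, cexp ((κ * eigenvalue q : ℝ) * t) * ((m j : ℂ) * fourierComp (b t) q j)
      = ∑ j, ((m j : ℂ) * fourierComp b₀ q j + (m j : ℂ) * ∫ s in (0 : ℝ)..t,
          cexp ((κ * eigenvalue q : ℝ) * s) * (f s * a j * forcing m c (b s) q)) :=
        Finset.sum_congr rfl fun j _ => by
          rw [← mul_add, ← fourierComp_eq hf hb haq j ht]; ring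
    _ = ∑ j, (m j : ℂ) * fourierComp b₀ q j := by
        rw [Finset.sum_add_distrib, hsum, add_zero]

/-- The weight with which the mode `r` is transferred to the mode `q` up to time `t`. -/
def transfer (κ : ℝ) (f : ℝ → ℝ) (q r : Fin 3 → ℤ) (t : ℝ) : ℝ :=
  ∫ s in (0 : ℝ)..t, Real.exp (κ * eigenvalue q * s) * f s * Real.exp (-(κ * eigenvalue r * s))

lemma continuous_transfer_integrand (hf : Continuous f) (q r : Fin 3 → ℤ) :
    Continuous fun s =>
      Real.exp (κ * eigenvalue q * s) * f s * Real.exp (-(κ * eigenvalue r * s)) := by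
  fun_prop

/-- The neighbours `q ± m` are again orthogonal to `a`, so their fluxes are the freely decaying
initial ones, and Duhamel's formula becomes explicit in `b₀`. -/
lemma fourierComp_eq_transfer (hf : Continuous f) (ham : ∑ j, a j * m j = 0)
    (hb : SolvesInduction κ (shearFlow f m c a) b₀ b) {q : Fin 3 → ℤ}
    (haq : ∑ j, a j * q j = 0) (p : Fin 3) {t : ℝ} (ht : 0 ≤ t) :
    cexp ((κ * eigenvalue q : ℝ) * t) * fourierComp (b t) q p = fourierComp b₀ q p +
      a p * Real.pi * I * (c * (transfer κ f q (q - m) t * fluxComp m b₀ (q - m)) -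
        conj c * (transfer κ f q (q + m) t * fluxComp m b₀ (q + m))) := by
  have hsub : ∑ j, a j * ((q - m) j : ℤ) = 0 := by
    simp [mul_sub, Finset.sum_sub_distrib, haq, ham]
  have hadd : ∑ j, a j * ((q + m) j : ℤ) = 0 := by
    simp [mul_add, Finset.sum_add_distrib, haq, ham]
  have hflux : ∀ r : Fin 3 → ℤ, ∑ j, a j * r j = 0 → ∀ s, 0 ≤ s →
      fluxComp m (b s) r = Real.exp (-(κ * eigenvalue r * s)) * fluxComp m b₀ r := by
    intro r har s hs
    rw [← fluxComp_eq hf ham hb har hs, ← mul_assoc, ofReal_exp, ← Complex.exp_add]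
    push_cast
    simp
  have hintC : ∀ r, IntervalIntegrable (fun s => ((Real.exp (κ * eigenvalue q * s) * f s *
      Real.exp (-(κ * eigenvalue r * s)) : ℝ) : ℂ)) volume 0 t := fun r =>
    (continuous_ofReal.comp (continuous_transfer_integrand (κ := κ) hf q r)).intervalIntegrable 0 t
  rw [fourierComp_eq hf hb haq p ht]
  congr 1
  simp only [transfer, ← intervalIntegral.integral_ofReal]
  simp only [← intervalIntegral.integral_mul_const, ← intervalIntegral.integral_const_mul]
  rw [← intervalIntegral.integral_sub (((hintC _).mul_const _).const_mul _)
    (((hintC _).mul_const _).const_mul _), ← intervalIntegral.integral_const_mul]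
  refine intervalIntegral.integral_congr fun s hs => ?_
  rw [uIcc_of_le ht] at hs
  simp only [forcing, hflux _ hsub s hs.1, hflux _ hadd s hs.1]
  push_cast
  ring

lemma transfer_eq_of_le (hfT : ∀ s, 1 ≤ s → f s = 0) (hf : Continuous f) (q r : Fin 3 → ℤ)
    {t : ℝ} (ht : 1 ≤ t) : transfer κ f q r t = transfer κ f q r 1 := by
  have hc := continuous_transfer_integrand (κ := κ) hf q r
  rw [transfer, ← intervalIntegral.integral_add_adjacent_intervals
    (hc.intervalIntegrable 0 1) (hc.intervalIntegrable 1 t), transfer, add_eq_left]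
  refine (intervalIntegral.integral_congr fun s hs => ?_).trans intervalIntegral.integral_zero
  rw [uIcc_of_le ht] at hs
  simp [hfT s hs.1]

lemma transfer_pos (hf : Continuous f) (hf0 : ∀ s, 0 ≤ f s) {s₀ : ℝ} (hs₀ : s₀ ∈ Ioo (0 : ℝ) 1)
    (hfs : 0 < f s₀) (q r : Fin 3 → ℤ) : 0 < transfer κ f q r 1 := by
  refine intervalIntegral.integral_pos zero_lt_one
    (continuous_transfer_integrand hf q r).continuousOn (fun s _ => ?_)
    ⟨s₀, Ioo_subset_Icc_self hs₀, ?_⟩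
  · have := hf0 s
    positivity
  · positivity

end ModeEquations

/-! ### Choice of direction, amplitude and time profile -/

lemma exists_ne_zero_orthogonal (v w : Fin 3 → ℝ) :
    ∃ a : EuclideanSpace ℝ (Fin 3), a ≠ 0 ∧ ∑ j, a j * v j = 0 ∧ ∑ j, a j * w j = 0 := by
  -- Repeating a row makes the matrix singular even when `v` and `w` are independent; `a` is a
  -- kernel vector.
  have hdet : (Matrix.of ![v, w, w]).det = 0 :=
    Matrix.det_zero_of_row_eq (i := 1) (j := 2) (by decide) rfl
  obtain ⟨a, ha, hM⟩ := Matrix.exists_mulVec_eq_zero_iff.2 hdet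
  refine ⟨WithLp.toLp 2 a, by simpa using ha, ?_, ?_⟩
  · simpa [Matrix.mulVec, dotProduct, mul_comm] using congrFun hM 0
  · simpa [Matrix.mulVec, dotProduct, mul_comm] using congrFun hM 1

lemma exists_mul_add_ne_zero {P Q J J' : ℂ} (hQ : Q ≠ 0) (hJ : J ≠ 0) {ε : ℝ} (hε : 0 < ε) :
    ∃ c : ℂ, ‖c‖ ≤ ε ∧ P + Q * (c * J - conj c * J') ≠ 0 := by
  by_contra! h
  have h0 := h 0 (by simpa using hε.le)
  have h1 := h ε (by simp [abs_of_pos hε])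
  have h2 := h (ε * I) (by simp [abs_of_pos hε])
  have hε' : (ε : ℂ) ≠ 0 := by exact_mod_cast hε.ne'
  simp only [map_zero, zero_mul, sub_zero, mul_zero, add_zero] at h0
  subst h0
  simp only [map_mul, conj_ofReal, conj_I, zero_add] at h1 h2
  -- Testing at `ε` and `ε * I` separates the linear part from the antilinear one: the `J'` terms
  -- cancel.
  have key : (2 * Q * ε * I) * J = 0 := by linear_combination I * h1 + h2
  simp [hQ, hJ, hε'] at key

/-- A nonnegative bump in `(0,1)`. -/
def timeBump : ContDiffBump (1 / 2 : ℝ) := ⟨1 / 8, 1 / 4, by norm_num, by norm_num⟩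

lemma contDiff_timeBump : ContDiff ℝ ∞ (timeBump : ℝ → ℝ) := timeBump.contDiff

lemma tsupport_timeBump_subset : tsupport (timeBump : ℝ → ℝ) ⊆ Ioo 0 1 := by
  rw [timeBump.tsupport_eq, Real.closedBall_eq_Icc]
  refine Icc_subset_Ioo ?_ ?_ <;> norm_num [timeBump]

lemma timeBump_eq_zero {s : ℝ} (hs : 1 ≤ s) : timeBump s = 0 :=
  image_eq_zero_of_notMem_tsupport fun h => hs.not_gt (tsupport_timeBump_subset h).2

lemma exists_bound_iteratedDeriv_timeBump (ℓ : ℕ) :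
    ∃ B, ∀ t, |iteratedDeriv ℓ (timeBump : ℝ → ℝ) t| ≤ B := by
  have hc : Continuous (iteratedDeriv ℓ (timeBump : ℝ → ℝ)) :=
    contDiff_timeBump.continuous_iteratedDeriv ℓ (by exact_mod_cast le_top)
  have hs : HasCompactSupport (iteratedDeriv ℓ (timeBump : ℝ → ℝ)) := by
    induction ℓ with
    | zero => simpa using timeBump.hasCompactSupport
    | succ n ih =>
      rw [iteratedDeriv_succ]
      exact (ih (contDiff_timeBump.continuous_iteratedDeriv n (by exact_mod_cast le_top))).deriv
  exact hs.exists_bound_of_continuous hc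

lemma sum_sq_pi_single (i : Fin 3) : ∑ j, (Pi.single i 1 : Fin 3 → ℤ) j ^ 2 = 1 := by
  fin_cases i <;> simp [Fin.sum_univ_three]

/-- Incompressibility says `k₀ · b̂₀(k₀) = 0`, so only the `e_i` part of `e_i - k₀` contributes. If
this component is nonzero, then `k₀ ≠ e_i` automatically. -/
lemma fluxComp_single_sub {b₀ : L2Field} (hb₀ : IsSolenoidalMeanZero b₀) (k₀ : Fin 3 → ℤ)
    (i : Fin 3) : fluxComp (Pi.single i 1 - k₀) b₀ k₀ = fourierComp b₀ k₀ i := by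
  have h := sum_mul_fourierComp_eq_zero hb₀ k₀
  simp only [fluxComp, Pi.sub_apply, Int.cast_sub, sub_mul, Finset.sum_sub_distrib, h, sub_zero]
  rw [Finset.sum_eq_single i] <;> simp +contextual

end Dynamo

end

theorem mainTheorem5 :
    ∃ C : ℕ → (Fin 3 → ℕ) → ℝ,
      ∀ (κ : ℝ), 0 ≤ κ →
      ∀ b₀ : Dynamo.L2Field, Dynamo.IsSolenoidalMeanZero b₀ → b₀ ≠ 0 →
      ∃ (T : ℝ) (k : Fin 3 → ℤ) (u : Dynamo.Velocity),
        0 < T ∧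
        ∑ i, k i ^ 2 = 1 ∧
        Dynamo.DivergenceFree u ∧
        Dynamo.SmoothCompactlySupported T u ∧
        (∀ (ℓ : ℕ) (α : Fin 3 → ℕ) (t : ℝ) (x : Dynamo.Torus3),
          ‖Dynamo.partialMixed ℓ α u t x‖ ≤ C ℓ α) ∧
        ∀ b : ℝ → Dynamo.L2Field, Dynamo.SolvesInduction κ u b₀ b →
          ∀ t : ℝ, T ≤ t → UnitAddTorus.mFourierCoeff (b t) k ≠ 0 := by
  open Dynamo in
  choose B hB using exists_bound_iteratedDeriv_timeBump
  refine ⟨fun ℓ α => ((∑ j, α j).factorial : ℝ) * B ℓ, fun κ _ b₀ hb₀ hne => ?_⟩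
  obtain ⟨k₀, i, hki⟩ := exists_fourierComp_ne_zero hne
  set k : Fin 3 → ℤ := Pi.single i 1 with hk
  set m : Fin 3 → ℤ := k - k₀ with hm
  have hflux : fluxComp m b₀ (k - m) ≠ 0 := by
    rw [hm, sub_sub_cancel, hk, fluxComp_single_sub hb₀]
    exact hki
  obtain ⟨a, ha, hak, hak₀⟩ := exists_ne_zero_orthogonal (fun j => (k j : ℝ)) fun j => (k₀ j : ℝ)
  have ham : ∑ j, a j * m j = 0 := by
    simp [hm, mul_sub, Finset.sum_sub_distrib, hak, hak₀]
  obtain ⟨p, hp⟩ : ∃ p, a p ≠ 0 := by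
    by_contra! h
    exact ha (by ext p; simpa using h p)
  have hf : Continuous (timeBump : ℝ → ℝ) := contDiff_timeBump.continuous
  have htr : 0 < transfer κ timeBump k (k - m) 1 :=
    transfer_pos hf (fun _ => timeBump.nonneg) (s₀ := 1 / 2) (by norm_num)
      (timeBump.pos_of_mem_ball (by simp [timeBump])) _ _
  have hQ : (a p * Real.pi * Complex.I : ℂ) ≠ 0 := by
    simp [hp, Real.pi_ne_zero]
  have hJ : (transfer κ timeBump k (k - m) 1 : ℂ) * fluxComp m b₀ (k - m) ≠ 0 :=
    mul_ne_zero (by exact_mod_cast htr.ne') hflux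
  -- The largest `‖c‖` for which the frequency-independent derivative bound applies.
  have hε : 0 < Real.exp (-(2 * Real.pi * ∑ j, |(m j : ℝ)|)) / ‖a‖ := by
    have := norm_pos_iff.2 ha
    positivity
  obtain ⟨c, hc, hcne⟩ := exists_mul_add_ne_zero (P := fourierComp b₀ k p)
    (J' := transfer κ timeBump k (k + m) 1 * fluxComp m b₀ (k + m)) hQ hJ hε
  rw [le_div_iff₀ (norm_pos_iff.2 ha)] at hc
  refine ⟨1, k, shearFlow timeBump m c a, one_pos, sum_sq_pi_single i,
    divergenceFree_shearFlow _ c ham,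
    smoothCompactlySupported_shearFlow contDiff_timeBump timeBump.hasCompactSupport
      tsupport_timeBump_subset m c a,
    fun ℓ α t x => norm_partialMixed_shearFlow_le_of_le_exp contDiff_timeBump hc (hB ℓ) α t x,
    fun b hb t ht hzero => hcne ?_⟩
  have hcoef : fourierComp (b t) k p = 0 := by
    rw [← mFourierCoeff_apply, hzero, PiLp.zero_apply]
  have key := fourierComp_eq_transfer hf ham hb hak p (zero_le_one.trans ht)
  -- The weights freeze at time `1`, so one choice of `c` excludes vanishing at every `t ≥ 1`.
  rw [hcoef, mul_zero, transfer_eq_of_le (fun _ hs => timeBump_eq_zero hs) hf _ _ ht,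
    transfer_eq_of_le (fun _ hs => timeBump_eq_zero hs) hf _ _ ht] at key
  exact key.symm
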